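/- **Proposition.** Let $k$ be a perfect field of characteristic $p>0$, let $\mathfrak h$ be a finite-dimensional abelian restricted Lie algebra over $k$, and let $\mathfrak g$ be a one-dimensional restricted Lie algebra over $k$ with a nonzero element $z$, so that $z^{[p]}+\lambda z=0$ for some $\lambda\in k$. Let $\rho:\mathfrak g\to \mathrm{End}_k(\mathfrak h)$ be an algebraic representation, i.e. a $k$-linear map with $$\rho_{[x,y]}=\rho_x\rho_y-\rho_y\rho_x,\quad \rho_{x^{[p]}}=(\rho_x)^p,\quad \rho_x([a,b])=[\rho_x(a),b]+[a,\rho_x(b)],\quad \rho_x(a^{[p]})=\rho_x(a)(\mathrm{ad}\,a)^{p-1}$$ for all $x,y\in\mathfrak g$, $a,b\in\mathfrak h$, where $v\,(\mathrm{ad}\,a)=[v,a]$. (Since $\mathfrak h$ is abelian, the last condition says that $\rho_x(a^{[p]})=0$.) Let $A=u(\mathfrak h)$ be the restricted enveloping algebra, a bialgebra in which the elements of $\mathfrak h$ are primitive, and let $A^+$ be its augmentation ideal. In the cobar construction $\Omega A=T(A^+)$, the differentials in degrees one and two are $d^1=-\overline\Delta$ and $d^2(a\otimes b)=-\overline\Delta(a)\otimes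 b+a\otimes\overline\Delta(b)$, where $\overline\Delta(a)=\Delta(a)-a\otimes1-1\otimes a$. Thus $\mathrm H^2(\Omega A)=\mathrm Z^2/\mathrm B^2$ with $\mathrm Z^2=\ker(d^2\colon A^+\otimes A^+\to A^+\otimes A^+\otimes A^+)$ and $\mathrm B^2=d^1(A^+)$. Extend $\rho_z$ to a derivation of $A$, and let it act on $A\otimes A$ as $\rho_z\otimes1+1\otimes\rho_z$. The operator $$\Phi_z(f)=f^p+\rho_z^{\,p-1}(f)+\lambda f$$ on $A^+\otimes A^+$, where $f^p$ is taken in the commutative algebra $A\otimes A$, induces an additive map $\Phi_z$ on $\mathrm H^2(\Omega A)$. A class $\xi\in\mathrm H^2(\Omega A)$ is called *$z$-characteristic* if $\Phi_z(\xi)=0$. A $z$-characteristic class $\xi$ is called *admissible* if it is represented by a cocycle $\chi$ for which there is some $a\in A^+$ with $\Phi_z(\chi)=d^1(a)$ and $\rho_z(a)=0$. A *torus* is a finite-dimensional abelian restricted Lie algebra $L$ such that every element of $L$ generates a semisimple subalgebra of $u(L)$. If $\mathfrak h$ or $\mathfrak g$ is a torus, then every $z$-characteristic element of $\mathrm H^2(\Omega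 A)$ is admissible. -/

import Mathlib

open scoped TensorProduct

set_option linter.unusedSectionVars false

/-- A restricted Lie algebra over a field `k` of characteristic `p` (Jacobson's axioms). The three
axioms are `(c x)^[p] = c^p x^[p]`, `ad (x^[p]) = (ad x)^p` and
`(x + y)^[p] = x^[p] + y^[p] + ∑_{0 < i < p} s_i(x, y)`, where `i s_i(x, y)` is the coefficient of
`t^(i - 1)` in `(ad (t x + y))^(p - 1) x`. That coefficient is written out as the sum over all words
of length `p - 1` in `ad x` and `ad y` which have exactly `i - 1` letters `ad x`. -/
class RestrictedLieAlgebra (p : ℕ) (k L : Type*) [Field k] [LieRing L] [LieAlgebra k L] where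
  /-- the `p`-map `x ↦ x^[p]` -/
  pmap : L → L
  pmap_smul : ∀ (c : k) (x : L), pmap (c • x) = c ^ p • pmap x
  ad_pmap : ∀ x : L, LieAlgebra.ad k L (pmap x) = LieAlgebra.ad k L x ^ p
  pmap_add : ∀ x y : L, pmap (x + y) = pmap x + pmap y +
    ∑ i ∈ Finset.Ico 1 p, (i : k)⁻¹ •
      ∑ S ∈ (Finset.univ : Finset (Fin (p - 1))).powersetCard (i - 1),
        (List.ofFn fun j => if j ∈ S then LieAlgebra.ad k L x else LieAlgebra.ad k L y).prod x

open RestrictedLieAlgebra (pmap)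

section Frobenius

variable {p : ℕ} (k : Type*) [Field k] [Fact p.Prime] [CharP k p]

theorem natCast_eq_zero_of_algebra (R : Type*) [Ring R] [Algebra k R] : (p : R) = 0 := by
  rw [← map_natCast (algebraMap k R), CharP.cast_eq_zero k p, map_zero]

theorem Commute.add_pow_of_algebra {R : Type*} [Ring R] [Algebra k R] {a b : R}
    (h : Commute a b) : (a + b) ^ p = a ^ p + b ^ p := by
  obtain ⟨r, hr⟩ := h.exists_add_pow_prime_eq (Fact.out : p.Prime)
  rw [hr, natCast_eq_zero_of_algebra k R]
  simp

theorem add_pow_of_algebra {R : Type*} [CommRing R] [Algebra k R] (a b : R) :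
    (a + b) ^ p = a ^ p + b ^ p :=
  (Commute.all a b).add_pow_of_algebra k

theorem sub_pow_of_algebra {R : Type*} [CommRing R] [Algebra k R] (a b : R) :
    (a - b) ^ p = a ^ p - b ^ p := by
  rw [eq_sub_iff_add_eq, ← add_pow_of_algebra k, sub_add_cancel]

end Frobenius

/-! ### The restricted enveloping algebra -/

section Enveloping

attribute [local instance 100] LieRing.ofAssociativeRing

variable (p : ℕ) (k L : Type*) [Field k] [LieRing L] [LieAlgebra k L] [RestrictedLieAlgebra p k L]

/-- The relations `x ^ p = x^[p]`, for `x` in `L`, on the enveloping algebra of `L`. -/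
inductive RestrictedEnvelopingAlgebra.Rel :
    UniversalEnvelopingAlgebra k L → UniversalEnvelopingAlgebra k L → Prop
  | pow (x : L) : RestrictedEnvelopingAlgebra.Rel
      (UniversalEnvelopingAlgebra.ι k x ^ p) (UniversalEnvelopingAlgebra.ι k (pmap p k x))

/-- The restricted enveloping algebra `u(L) = U(L) / (x ^ p - x^[p])`. -/
def RestrictedEnvelopingAlgebra : Type _ := RingQuot (RestrictedEnvelopingAlgebra.Rel p k L)

namespace RestrictedEnvelopingAlgebra

noncomputable instance : Ring (RestrictedEnvelopingAlgebra p k L) :=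
  inferInstanceAs (Ring (RingQuot (Rel p k L)))

noncomputable instance : Algebra k (RestrictedEnvelopingAlgebra p k L) :=
  inferInstanceAs (Algebra k (RingQuot (Rel p k L)))

/-- The quotient map `U(L) → u(L)`. -/
noncomputable def mk : UniversalEnvelopingAlgebra k L →ₐ[k] RestrictedEnvelopingAlgebra p k L :=
  RingQuot.mkAlgHom k (Rel p k L)

variable {L}

/-- The canonical linear map `L → u(L)`. -/
noncomputable def ι : L →ₗ[k] RestrictedEnvelopingAlgebra p k L :=
  (mk p k L).toLinearMap ∘ₗ (UniversalEnvelopingAlgebra.ι k : L →ₗ⁅k⁆ _).toLinearMap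

theorem ι_pow (x : L) : ι p k x ^ p = ι p k (pmap p k x) := by
  have h : mk p k L (UniversalEnvelopingAlgebra.ι k x ^ p) =
      mk p k L (UniversalEnvelopingAlgebra.ι k (pmap p k x)) :=
    RingQuot.mkAlgHom_rel k (Rel.pow x)
  rw [map_pow] at h
  exact h

theorem ι_lie (x y : L) : ι p k ⁅x, y⁆ = ι p k x * ι p k y - ι p k y * ι p k x := by
  change mk p k L (UniversalEnvelopingAlgebra.ι k ⁅x, y⁆) = _
  rw [LieHom.map_lie, LieRing.of_associative_ring_bracket, map_sub, map_mul, map_mul]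
  rfl

variable {p k} in
/-- The universal property of `u(L)`. -/
noncomputable def lift {B : Type*} [Ring B] [Algebra k B] (f : L →ₗ[k] B)
    (hlie : ∀ x y, f ⁅x, y⁆ = f x * f y - f y * f x) (hpow : ∀ x, f x ^ p = f (pmap p k x)) :
    RestrictedEnvelopingAlgebra p k L →ₐ[k] B :=
  RingQuot.liftAlgHom k
    ⟨UniversalEnvelopingAlgebra.lift k
      { f with map_lie' := fun {x y} => by
                simpa [LieRing.of_associative_ring_bracket] using hlie x y }, by
      rintro _ _ ⟨x⟩
      rw [map_pow, UniversalEnvelopingAlgebra.lift_ι_apply, UniversalEnvelopingAlgebra.lift_ι_apply]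
      exact hpow x⟩

@[simp]
theorem lift_ι {B : Type*} [Ring B] [Algebra k B] (f : L →ₗ[k] B)
    (hlie : ∀ x y, f ⁅x, y⁆ = f x * f y - f y * f x) (hpow : ∀ x, f x ^ p = f (pmap p k x))
    (x : L) : lift f hlie hpow (ι p k x) = f x := by
  change RingQuot.liftAlgHom k _ (RingQuot.mkAlgHom k _ (UniversalEnvelopingAlgebra.ι k x)) = _
  rw [RingQuot.liftAlgHom_mkAlgHom_apply, UniversalEnvelopingAlgebra.lift_ι_apply]
  rfl

variable {p k} in
theorem hom_ext {B : Type*} [Ring B] [Algebra k B]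
    {f g : RestrictedEnvelopingAlgebra p k L →ₐ[k] B}
    (h : ∀ x : L, f (ι p k x) = g (ι p k x)) : f = g := by
  apply RingQuot.ringQuot_ext'
  apply UniversalEnvelopingAlgebra.hom_ext
  ext x
  exact h x

theorem adjoin_range_ι : Algebra.adjoin k (Set.range (ι p k : L → _)) = ⊤ := by
  set S := Algebra.adjoin k (Set.range (ι p k : L → RestrictedEnvelopingAlgebra p k L))
  have hmem : ∀ x : L, ι p k x ∈ S := fun x => Algebra.subset_adjoin ⟨x, rfl⟩
  let f : RestrictedEnvelopingAlgebra p k L →ₐ[k] S :=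
    lift ((ι p k).codRestrict (Subalgebra.toSubmodule S) hmem : L →ₗ[k] S)
      (fun x y => Subtype.ext (ι_lie p k x y)) (fun x => Subtype.ext (ι_pow p k x))
  have hf : S.val.comp f = AlgHom.id k _ := by
    apply hom_ext
    intro x
    rw [AlgHom.comp_apply, lift_ι]
    rfl
  rw [eq_top_iff]
  intro a _
  have := DFunLike.congr_fun hf a
  simp only [AlgHom.comp_apply, AlgHom.id_apply] at this
  rw [← this]
  exact (f a).2

variable {p k} in
theorem induction_on {P : RestrictedEnvelopingAlgebra p k L → Prop}
    (a : RestrictedEnvelopingAlgebra p k L) (hι : ∀ x, P (ι p k x))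
    (hc : ∀ c : k, P (algebraMap k _ c)) (hadd : ∀ a b, P a → P b → P (a + b))
    (hmul : ∀ a b, P a → P b → P (a * b)) : P a := by
  have ha : a ∈ Algebra.adjoin k (Set.range (ι p k : L → _)) := by
    rw [adjoin_range_ι]; trivial
  induction ha using Algebra.adjoin_induction with
  | mem x hx => obtain ⟨x, rfl⟩ := hx; exact hι x
  | algebraMap c => exact hc c
  | add a b _ _ h1 h2 => exact hadd a b h1 h2
  | mul a b _ _ h1 h2 => exact hmul a b h1 h2

/-- The restricted enveloping algebra of an abelian restricted Lie algebra is commutative. -/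
noncomputable instance [IsLieAbelian L] : CommRing (RestrictedEnvelopingAlgebra p k L) :=
  { (inferInstance : Ring (RestrictedEnvelopingAlgebra p k L)) with
    mul_comm := fun a b => by
      change Commute a b
      refine induction_on (P := fun a => Commute a b) a (fun x => ?_)
        (fun c => Algebra.commutes c b) (fun a a' h h' => h.add_left h')
        (fun a a' h h' => h.mul_left h')
      refine induction_on (P := fun b => Commute (ι p k x) b) b (fun y => ?_)
        (fun c => (Algebra.commutes c _).symm) (fun a a' h h' => h.add_right h')
        (fun a a' h h' => h.mul_right h')
      have := ι_lie p k x y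
      rw [trivial_lie_zero, map_zero] at this
      exact (sub_eq_zero.mp this.symm) }

variable (L) [Fact p.Prime] [CharP k p]

/-- The comultiplication of `u(L)`, for which the elements of `L` are primitive. -/
noncomputable def comulHom : RestrictedEnvelopingAlgebra p k L →ₐ[k]
    RestrictedEnvelopingAlgebra p k L ⊗[k] RestrictedEnvelopingAlgebra p k L :=
  lift ((TensorProduct.mk k _ _).flip 1 ∘ₗ ι p k + TensorProduct.mk k _ _ 1 ∘ₗ ι p k)
    (fun x y => by
      simp only [LinearMap.add_apply, LinearMap.comp_apply, LinearMap.flip_apply,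
        TensorProduct.mk_apply, ι_lie, mul_add, add_mul, Algebra.TensorProduct.tmul_mul_tmul,
        one_mul, mul_one, TensorProduct.sub_tmul, TensorProduct.tmul_sub]
      abel)
    (fun x => by
      simp only [LinearMap.add_apply, LinearMap.comp_apply, LinearMap.flip_apply,
        TensorProduct.mk_apply]
      rw [Commute.add_pow_of_algebra k, Algebra.TensorProduct.tmul_pow,
        Algebra.TensorProduct.tmul_pow, one_pow, ι_pow]
      simp [Commute, SemiconjBy])

/-- The counit of `u(L)`, which vanishes on `L`. -/
noncomputable def counitHom : RestrictedEnvelopingAlgebra p k L →ₐ[k] k :=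
  lift 0 (fun x y => by simp) (fun x => by simp [(Fact.out : p.Prime).ne_zero])

@[simp]
theorem comulHom_ι (x : L) : comulHom p k L (ι p k x) = ι p k x ⊗ₜ 1 + 1 ⊗ₜ ι p k x := by
  simp [comulHom]

@[simp]
theorem counitHom_ι (x : L) : counitHom p k L (ι p k x) = 0 := by
  simp [counitHom]

noncomputable instance : Bialgebra k (RestrictedEnvelopingAlgebra p k L) :=
  Bialgebra.ofAlgHom (comulHom p k L) (counitHom p k L)
    (by
      apply hom_ext
      intro x
      simp [TensorProduct.add_tmul, TensorProduct.tmul_add, Algebra.TensorProduct.one_def,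
        add_assoc])
    (by
      apply hom_ext
      intro x
      simp)
    (by
      apply hom_ext
      intro x
      simp)

variable {L}

@[simp]
theorem comul_ι (x : L) :
    Coalgebra.comul (R := k) (ι p k x) = ι p k x ⊗ₜ[k] 1 + 1 ⊗ₜ[k] ι p k x :=
  comulHom_ι p k L x

@[simp]
theorem counit_ι (x : L) : Coalgebra.counit (R := k) (ι p k x) = 0 :=
  counitHom_ι p k L x

end RestrictedEnvelopingAlgebra

/-- A torus: an abelian finite-dimensional restricted Lie algebra `L` such that every `x` in `L`
generates a semisimple subalgebra of `u(L)`. -/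
structure IsTorus : Prop where
  isLieAbelian : IsLieAbelian L
  finite : Module.Finite k L
  isSemisimple : ∀ x : L, IsSemisimpleRing (Algebra.adjoin k {RestrictedEnvelopingAlgebra.ι p k x})

end Enveloping

/-! ### Algebraic representations -/

/-- An algebraic representation of a restricted Lie algebra `g` on a restricted Lie algebra `h`.
In `map_pmap`, the operator `ad a` acts from the right, `v (ad a) = [v, a]`, hence the sign. -/
structure AlgebraicRep (p : ℕ) (k g h : Type*) [Field k] [LieRing g] [LieAlgebra k g]
    [LieRing h] [LieAlgebra k h] [RestrictedLieAlgebra p k g] [RestrictedLieAlgebra p k h] where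
  /-- the underlying linear map, `x ↦ ρ_x` -/
  toLinearMap : g →ₗ[k] Module.End k h
  lie : ∀ x y : g, toLinearMap ⁅x, y⁆ =
    toLinearMap x * toLinearMap y - toLinearMap y * toLinearMap x
  pmap : ∀ x : g, toLinearMap (RestrictedLieAlgebra.pmap p k x) = toLinearMap x ^ p
  map_lie : ∀ (x : g) (a b : h), toLinearMap x ⁅a, b⁆ = ⁅toLinearMap x a, b⁆ + ⁅a, toLinearMap x b⁆
  map_pmap : ∀ (x : g) (a : h), toLinearMap x (RestrictedLieAlgebra.pmap p k a) =
    ((-LieAlgebra.ad k h a) ^ (p - 1)) (toLinearMap x a)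

/-! ### The cobar construction in low degrees -/

namespace Cobar

section Complex

variable (k A : Type*) [Field k] [Ring A] [Bialgebra k A]

/-- The augmentation ideal `A⁺`, i.e. the cochains of degree one of `ΩA`. -/
noncomputable def C1 : Submodule k A := LinearMap.ker (Coalgebra.counit : A →ₗ[k] k)

/-- The cochains of degree two of `ΩA`, i.e. the subspace `A⁺ ⊗ A⁺` of `A ⊗ A`. -/
noncomputable def C2 : Submodule k (A ⊗[k] A) :=
  LinearMap.range (TensorProduct.mapIncl (C1 k A) (C1 k A))

/-- The reduced comultiplication `a ↦ Δ a - a ⊗ 1 - 1 ⊗ a`. -/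
noncomputable def redComul : A →ₗ[k] A ⊗[k] A :=
  Coalgebra.comul - (TensorProduct.mk k A A).flip 1 - TensorProduct.mk k A A 1

/-- The differential `d¹ a = - redComul a`. It is given on all of `A`, but only its restriction to
`A⁺` is the differential of `ΩA`. -/
noncomputable def d1 : A →ₗ[k] A ⊗[k] A := -redComul k A

/-- The differential `d² (a ⊗ b) = - redComul a ⊗ b + a ⊗ redComul b`. It is given on all of
`A ⊗ A`, but only its restriction to `A⁺ ⊗ A⁺` is the differential of `ΩA`. -/
noncomputable def d2 : A ⊗[k] A →ₗ[k] A ⊗[k] (A ⊗[k] A) :=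
  -((TensorProduct.assoc k A A A).toLinearMap ∘ₗ (redComul k A).rTensor A) +
    (redComul k A).lTensor A

/-- The 2-cocycles of `ΩA`. -/
noncomputable def Z2 : Submodule k (A ⊗[k] A) := C2 k A ⊓ LinearMap.ker (d2 k A)

/-- The 2-coboundaries of `ΩA`. -/
noncomputable def B2 : Submodule k (A ⊗[k] A) := (C1 k A).map (d1 k A)

/-- The second cohomology `H²(ΩA)`. -/
abbrev H2 : Type _ := Z2 k A ⧸ (B2 k A).submoduleOf (Z2 k A)

variable {k A}

theorem mem_C1 {a : A} : a ∈ C1 k A ↔ Coalgebra.counit (R := k) a = 0 := LinearMap.mem_ker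

theorem d1_apply (a : A) : d1 k A a = a ⊗ₜ 1 + 1 ⊗ₜ a - Coalgebra.comul (R := k) a := by
  simp only [d1, redComul, LinearMap.neg_apply, LinearMap.sub_apply, LinearMap.flip_apply,
    TensorProduct.mk_apply]
  abel

theorem d2_apply (t : A ⊗[k] A) : d2 k A t =
    1 ⊗ₜ t - TensorProduct.assoc k A A A (Coalgebra.comul.rTensor A t) +
      Coalgebra.comul.lTensor A t - TensorProduct.assoc k A A A (t ⊗ₜ 1) := by
  induction t with
  | zero => simp
  | add x y hx hy =>
    rw [map_add, hx, hy]
    simp only [map_add, TensorProduct.tmul_add, TensorProduct.add_tmul]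
    abel
  | tmul a b =>
    simp only [d2, redComul, LinearMap.add_apply, LinearMap.neg_apply, LinearMap.comp_apply,
      LinearMap.rTensor_tmul, LinearMap.lTensor_tmul, LinearMap.sub_apply, LinearMap.flip_apply,
      TensorProduct.mk_apply, LinearEquiv.coe_coe, TensorProduct.sub_tmul, TensorProduct.tmul_sub,
      map_sub, TensorProduct.assoc_tmul]
    abel

theorem d1_mem_C2 {a : A} (ha : a ∈ C1 k A) : d1 k A a ∈ C2 k A := by
  -- the projection `A → A⁺`
  let π : A →ₗ[k] C1 k A := LinearMap.codRestrict (C1 k A)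
    (LinearMap.id - Algebra.linearMap k A ∘ₗ Coalgebra.counit) (fun a => by
      rw [mem_C1]
      simp [Algebra.linearMap_apply, Algebra.algebraMap_eq_smul_one])
  have hπ : ∀ t : A ⊗[k] A, TensorProduct.mapIncl (C1 k A) (C1 k A) (TensorProduct.map π π t) =
      t - TensorProduct.rid k A (Coalgebra.counit.lTensor A t) ⊗ₜ[k] (1 : A)
        - (1 : A) ⊗ₜ[k] TensorProduct.lid k A (Coalgebra.counit.rTensor A t)
        + Coalgebra.counit (R := k) (TensorProduct.lid k A (Coalgebra.counit.rTensor A t)) •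
          ((1 : A) ⊗ₜ[k] (1 : A)) := by
    intro t
    induction t with
    | zero => simp
    | add x y hx hy =>
      rw [map_add, map_add, hx, hy]
      simp only [map_add, TensorProduct.tmul_add, TensorProduct.add_tmul, add_smul]
      abel
    | tmul a b =>
      simp [TensorProduct.mapIncl, π, Algebra.algebraMap_eq_smul_one, TensorProduct.tmul_sub,
        TensorProduct.sub_tmul, TensorProduct.smul_tmul]
      rw [smul_sub, smul_smul, mul_comm (Coalgebra.counit (R := k) b)]
      abel
  have h := hπ (Coalgebra.comul (R := k) a)
  rw [Coalgebra.lTensor_counit_comul, Coalgebra.rTensor_counit_comul] at h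
  simp only [TensorProduct.rid_tmul, TensorProduct.lid_tmul, one_smul, mem_C1.mp ha, zero_smul,
    add_zero] at h
  refine ⟨-TensorProduct.map π π (Coalgebra.comul (R := k) a), ?_⟩
  rw [map_neg (TensorProduct.mapIncl (C1 k A) (C1 k A)), h, d1_apply]
  abel

theorem d2_d1 (a : A) : d2 k A (d1 k A a) = 0 := by
  simp only [d1_apply, d2_apply, map_sub, map_add, LinearMap.rTensor_tmul, LinearMap.lTensor_tmul,
    Bialgebra.comul_one, Algebra.TensorProduct.one_def, TensorProduct.assoc_tmul,
    Coalgebra.coassoc_apply]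
  abel

theorem B2_le_Z2 : B2 k A ≤ Z2 k A := by
  rintro _ ⟨a, ha, rfl⟩
  exact ⟨d1_mem_C2 ha, d2_d1 a⟩

end Complex

section ZOperator

variable {p : ℕ} [Fact p.Prime] {k : Type*} [Field k] [CharP k p]

/-- The operator `f ↦ f ^ p + δ^(p - 1) f + lam f` on a commutative algebra with a linear
endomorphism `δ`. -/
noncomputable def zOp (p : ℕ) {R : Type*} [CommRing R] [Algebra k R] (δ : R →ₗ[k] R) (lam : k)
    (f : R) : R :=
  f ^ p + (δ ^ (p - 1)) f + lam • f

theorem zOp_add {R : Type*} [CommRing R] [Algebra k R] (δ : R →ₗ[k] R) (lam : k) (f g : R) :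
    zOp p δ lam (f + g) = zOp p δ lam f + zOp p δ lam g := by
  simp only [zOp, add_pow_of_algebra k, map_add, smul_add]
  abel

theorem map_zOp {R S : Type*} [CommRing R] [Algebra k R] [CommRing S] [Algebra k S]
    {δ : R →ₗ[k] R} {δ' : S →ₗ[k] S} (lam : k) {F : R →ₗ[k] S}
    (hp : ∀ x, F (x ^ p) = F x ^ p) (hδ : ∀ x, F (δ x) = δ' (F x)) (f : R) :
    F (zOp p δ lam f) = zOp p δ' lam (F f) := by
  have h : ∀ n : ℕ, ∀ x, F ((δ ^ n) x) = (δ' ^ n) (F x) := by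
    intro n
    induction n with
    | zero => intro x; rfl
    | succ n ih => intro x; rw [pow_succ, pow_succ, Module.End.mul_apply, ih, hδ]; rfl
  simp only [zOp, map_add, map_smul, hp, h]

variable {A : Type*} [CommRing A] [Bialgebra k A]

/-- The action `δ ⊗ 1 + 1 ⊗ δ` on `A ⊗ A` of a primitive element which acts as `δ` on `A`. -/
noncomputable def act2 (δ : A →ₗ[k] A) : A ⊗[k] A →ₗ[k] A ⊗[k] A := δ.rTensor A + δ.lTensor A

/-- The action `δ ⊗ 1 ⊗ 1 + 1 ⊗ δ ⊗ 1 + 1 ⊗ 1 ⊗ δ` on `A ⊗ A ⊗ A` of a primitive element which acts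
as `δ` on `A`. -/
noncomputable def act3 (δ : A →ₗ[k] A) : A ⊗[k] (A ⊗[k] A) →ₗ[k] A ⊗[k] (A ⊗[k] A) :=
  δ.rTensor (A ⊗[k] A) + (act2 δ).lTensor A

theorem d1_pow (a : A) : d1 k A (a ^ p) = d1 k A a ^ p := by
  rw [d1_apply, d1_apply, sub_pow_of_algebra k, add_pow_of_algebra k, Bialgebra.comul_pow,
    Algebra.TensorProduct.tmul_pow, Algebra.TensorProduct.tmul_pow, one_pow]

theorem d2_pow (t : A ⊗[k] A) : d2 k A (t ^ p) = d2 k A t ^ p := by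
  have h1 : ∀ t : A ⊗[k] A, TensorProduct.assoc k A A A (Coalgebra.comul.rTensor A t) =
      Algebra.TensorProduct.assoc k k k A A A
        (Algebra.TensorProduct.map (Bialgebra.comulAlgHom k A) (AlgHom.id k A) t) := fun _ => rfl
  have h2 : ∀ t : A ⊗[k] A, Coalgebra.comul.lTensor A t =
      Algebra.TensorProduct.map (AlgHom.id k A) (Bialgebra.comulAlgHom k A) t := fun _ => rfl
  have h3 : ∀ t : (A ⊗[k] A) ⊗[k] A, TensorProduct.assoc k A A A t =
      Algebra.TensorProduct.assoc k k k A A A t := fun _ => rfl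
  have h4 : ∀ a b c d : A ⊗[k] (A ⊗[k] A),
      (a - b + c - d) ^ p = a ^ p - b ^ p + c ^ p - d ^ p := fun a b c d => by
    rw [sub_pow_of_algebra k, add_pow_of_algebra k, sub_pow_of_algebra k]
  rw [d2_apply, d2_apply]
  refine Eq.trans ?_ (h4 _ _ _ _).symm
  rw [h1, h1, h2, h2, h3, h3, ← map_pow, ← map_pow, ← map_pow, ← map_pow,
    Algebra.TensorProduct.tmul_pow, Algebra.TensorProduct.tmul_pow, one_pow]

variable {δ : A →ₗ[k] A}

theorem d1_act (h1 : δ 1 = 0)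
    (hΔ : ∀ a, Coalgebra.comul (R := k) (δ a) = act2 δ (Coalgebra.comul (R := k) a)) (a : A) :
    d1 k A (δ a) = act2 δ (d1 k A a) := by
  simp [d1_apply, hΔ, act2, h1]
  abel

theorem d2_act (h1 : δ 1 = 0)
    (hΔ : ∀ a, Coalgebra.comul (R := k) (δ a) = act2 δ (Coalgebra.comul (R := k) a))
    (t : A ⊗[k] A) : d2 k A (act2 δ t) = act3 δ (d2 k A t) := by
  have h : ∀ a, redComul k A (δ a) = act2 δ (redComul k A a) := fun a => by
    have := d1_act h1 hΔ a
    simpa [d1] using this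
  have h3 : ∀ (s : A ⊗[k] A) (b : A), TensorProduct.assoc k A A A (act2 δ s ⊗ₜ b) +
      TensorProduct.assoc k A A A (s ⊗ₜ δ b) = act3 δ (TensorProduct.assoc k A A A (s ⊗ₜ b)) := by
    intro s b
    induction s with
    | zero => simp
    | add x y hx hy =>
      simp only [map_add, TensorProduct.add_tmul, ← hx, ← hy]
      abel
    | tmul x y =>
      simp [act2, act3, TensorProduct.add_tmul]
      abel
  induction t with
  | zero => simp
  | add x y hx hy => simp only [map_add, hx, hy]
  | tmul a b =>
    simp only [d2, act2, LinearMap.add_apply, LinearMap.neg_apply, LinearMap.comp_apply,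
      LinearMap.rTensor_tmul, LinearMap.lTensor_tmul, LinearEquiv.coe_coe, map_add, map_neg, h]
    rw [← h3]
    simp only [act3, LinearMap.add_apply, LinearMap.rTensor_tmul, LinearMap.lTensor_tmul]
    simp only [act2, LinearMap.add_apply, TensorProduct.tmul_add]
    abel

theorem pow_mem_C2 {t : A ⊗[k] A} (ht : t ∈ C2 k A) : t ^ p ∈ C2 k A := by
  obtain ⟨s, rfl⟩ := ht
  induction s with
  | zero => simp [(Fact.out : p.Prime).ne_zero]
  | add x y hx hy =>
    rw [map_add, add_pow_of_algebra k]
    exact add_mem hx hy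
  | tmul a b =>
    refine ⟨⟨(a : A) ^ p, ?_⟩ ⊗ₜ ⟨(b : A) ^ p, ?_⟩, ?_⟩
    · rw [mem_C1, Bialgebra.counit_pow, mem_C1.mp a.2, zero_pow (Fact.out : p.Prime).ne_zero]
    · rw [mem_C1, Bialgebra.counit_pow, mem_C1.mp b.2, zero_pow (Fact.out : p.Prime).ne_zero]
    · simp [TensorProduct.mapIncl, Algebra.TensorProduct.tmul_pow]

theorem act2_mem_C2 (hε : ∀ a, Coalgebra.counit (R := k) (δ a) = 0) {t : A ⊗[k] A}
    (ht : t ∈ C2 k A) : act2 δ t ∈ C2 k A := by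
  obtain ⟨s, rfl⟩ := ht
  induction s with
  | zero => simp
  | add x y hx hy =>
    rw [map_add, map_add]
    exact add_mem hx hy
  | tmul a b =>
    refine ⟨⟨δ a, mem_C1.mpr (hε _)⟩ ⊗ₜ b + a ⊗ₜ ⟨δ b, mem_C1.mpr (hε _)⟩, ?_⟩
    simp [TensorProduct.mapIncl, act2]

theorem zOp_mem_Z2 (h1 : δ 1 = 0)
    (hΔ : ∀ a, Coalgebra.comul (R := k) (δ a) = act2 δ (Coalgebra.comul (R := k) a))
    (hε : ∀ a, Coalgebra.counit (R := k) (δ a) = 0) (lam : k) {t : A ⊗[k] A} (ht : t ∈ Z2 k A) :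
    zOp p (act2 δ) lam t ∈ Z2 k A := by
  constructor
  · refine add_mem (add_mem (pow_mem_C2 ht.1) ?_) (Submodule.smul_mem _ _ ht.1)
    generalize p - 1 = n
    induction n with
    | zero => exact ht.1
    | succ n ih => rw [pow_succ', Module.End.mul_apply]; exact act2_mem_C2 hε ih
  · change d2 k A _ = 0
    rw [map_zOp (δ' := act3 δ) lam d2_pow (d2_act h1 hΔ),
      LinearMap.mem_ker.mp ht.2]
    simp [zOp, (Fact.out : p.Prime).ne_zero]

theorem zOp_mem_B2 (h1 : δ 1 = 0)
    (hΔ : ∀ a, Coalgebra.comul (R := k) (δ a) = act2 δ (Coalgebra.comul (R := k) a))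
    (hε : ∀ a, Coalgebra.counit (R := k) (δ a) = 0) (lam : k) {t : A ⊗[k] A} (ht : t ∈ B2 k A) :
    zOp p (act2 δ) lam t ∈ B2 k A := by
  obtain ⟨a, ha, rfl⟩ := ht
  refine ⟨zOp p δ lam a, ?_, map_zOp lam d1_pow (d1_act h1 hΔ) a⟩
  have hδ : ∀ n : ℕ, (δ ^ n) a ∈ C1 k A := by
    intro n
    induction n with
    | zero => exact ha
    | succ n ih => rw [pow_succ', Module.End.mul_apply]; exact mem_C1.mpr (hε _)
  refine add_mem (add_mem ?_ (hδ _)) (Submodule.smul_mem _ _ ha)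
  rw [mem_C1, Bialgebra.counit_pow, mem_C1.mp ha, zero_pow (Fact.out : p.Prime).ne_zero]

end ZOperator

end Cobar

/-! ### The operator of a type -/

namespace AlgebraicRep

variable {p : ℕ} [Fact p.Prime] {k g h : Type*} [Field k] [CharP k p] [LieRing g] [LieAlgebra k g]
  [LieRing h] [LieAlgebra k h] [RestrictedLieAlgebra p k g] [RestrictedLieAlgebra p k h]
  [IsLieAbelian h] (ρ : AlgebraicRep p k g h) (z : g)

open RestrictedEnvelopingAlgebra

theorem map_pmap_of_isLieAbelian (a : h) : ρ.toLinearMap z (RestrictedLieAlgebra.pmap p k a) = 0 := by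
  have hp : p - 1 ≠ 0 := Nat.sub_ne_zero_of_lt (Fact.out : p.Prime).one_lt
  have had : LieAlgebra.ad k h a = 0 := by
    ext b
    exact trivial_lie_zero _ _ a b
  rw [ρ.map_pmap, had, neg_zero, zero_pow hp, LinearMap.zero_apply]

/-- The algebra map `a ↦ a + (z · a) ε` from `u(h)` to the dual numbers over `u(h)`. -/
noncomputable def dualHom : RestrictedEnvelopingAlgebra p k h →ₐ[k]
    TrivSqZeroExt (RestrictedEnvelopingAlgebra p k h) (RestrictedEnvelopingAlgebra p k h) :=
  RestrictedEnvelopingAlgebra.lift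
    ((TrivSqZeroExt.inlAlgHom k _ _).toLinearMap ∘ₗ ι p k +
      (TrivSqZeroExt.inrHom _ _).restrictScalars k ∘ₗ ι p k ∘ₗ ρ.toLinearMap z)
    (fun x y => by rw [trivial_lie_zero, map_zero, mul_comm, sub_self])
    (fun x => by
      ext
      · simp [ι_pow]
      · simp [map_pmap_of_isLieAbelian, TrivSqZeroExt.snd_pow, natCast_eq_zero_of_algebra k])

@[simp]
theorem fst_dualHom (a : RestrictedEnvelopingAlgebra p k h) : (ρ.dualHom z a).fst = a := by
  have : (TrivSqZeroExt.fstHom k _ _).comp (ρ.dualHom z) = AlgHom.id k _ := by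
    apply hom_ext
    intro x
    simp [dualHom]
  exact DFunLike.congr_fun this a

/-- The action of `z` on `u(h)`, i.e. the derivation of `u(h)` which extends `ρ_z`. -/
noncomputable def der :
    Derivation k (RestrictedEnvelopingAlgebra p k h) (RestrictedEnvelopingAlgebra p k h) :=
  Derivation.mk' ((TrivSqZeroExt.sndHom _ _).restrictScalars k ∘ₗ (ρ.dualHom z).toLinearMap)
    (fun a b => by simp [mul_comm])

@[simp]
theorem der_ι (x : h) : ρ.der z (ι p k x) = ι p k (ρ.toLinearMap z x) := by
  simp [der, dualHom]

/-- The action of `z` on `u(h)` as a linear map. -/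
noncomputable abbrev act :
    RestrictedEnvelopingAlgebra p k h →ₗ[k] RestrictedEnvelopingAlgebra p k h :=
  (ρ.der z).toLinearMap

theorem counit_act (a : RestrictedEnvelopingAlgebra p k h) :
    Coalgebra.counit (R := k) (ρ.act z a) = 0 := by
  induction a using induction_on with
  | hι x => simp [act]
  | hc c => simp [act]
  | hadd a b ha hb => rw [map_add, map_add, ha, hb, add_zero]
  | hmul a b ha hb => simp_all [act]

theorem comul_act (a : RestrictedEnvelopingAlgebra p k h) :
    Coalgebra.comul (R := k) (ρ.act z a) = Cobar.act2 (ρ.act z) (Coalgebra.comul (R := k) a) := by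
  have hmul : ∀ s t, Cobar.act2 (ρ.act z) (s * t) =
      s * Cobar.act2 (ρ.act z) t + t * Cobar.act2 (ρ.act z) s := by
    intro s t
    induction s with
    | zero => simp
    | add x y hx hy => simp only [add_mul, mul_add, map_add, hx, hy]; abel
    | tmul a b =>
      induction t with
      | zero => simp
      | add x y hx hy => simp only [add_mul, mul_add, map_add, hx, hy]; abel
      | tmul c d =>
        simp [act, Cobar.act2, TensorProduct.add_tmul, TensorProduct.tmul_add, mul_add]
        simp only [mul_comm]
        abel
  induction a using induction_on with
  | hι x => simp [act, Cobar.act2]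
  | hc c => simp [act, Cobar.act2, Algebra.algebraMap_eq_smul_one, Algebra.TensorProduct.one_def]
  | hadd a b ha hb => simp only [map_add, ha, hb]
  | hmul a b ha hb =>
    rw [Bialgebra.comul_mul, hmul, ← ha, ← hb]
    simp [act]

/-- The `z`-operator `f ↦ f ^ p + ρ_z^(p - 1) f + lam f` on the cochains of degree two of
`Ω u(h)`, where `z ^ p + lam z = 0`. -/
noncomputable def zOperator (lam : k) (f : RestrictedEnvelopingAlgebra p k h ⊗[k]
    RestrictedEnvelopingAlgebra p k h) :
    RestrictedEnvelopingAlgebra p k h ⊗[k] RestrictedEnvelopingAlgebra p k h :=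
  Cobar.zOp p (Cobar.act2 (ρ.act z)) lam f

/-- The additive map which the `z`-operator induces on the 2-cocycles. -/
noncomputable def zOperatorZ2 (lam : k) : Cobar.Z2 k (RestrictedEnvelopingAlgebra p k h) →+
    Cobar.Z2 k (RestrictedEnvelopingAlgebra p k h) :=
  AddMonoidHom.mk' (fun f => ⟨ρ.zOperator z lam f,
      Cobar.zOp_mem_Z2 (ρ.der z).map_one_eq_zero (ρ.comul_act z) (ρ.counit_act z) lam f.2⟩)
    (fun _ _ => Subtype.ext (Cobar.zOp_add _ lam _ _))

/-- The additive map which the `z`-operator induces on `H²(Ω u(h))`. -/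
noncomputable def zOperatorH2 (lam : k) : Cobar.H2 k (RestrictedEnvelopingAlgebra p k h) →+
    Cobar.H2 k (RestrictedEnvelopingAlgebra p k h) :=
  QuotientAddGroup.map _ _ (ρ.zOperatorZ2 z lam) (fun _ hf =>
    Cobar.zOp_mem_B2 (ρ.der z).map_one_eq_zero (ρ.comul_act z) (ρ.counit_act z) lam hf)

@[simp]
theorem zOperatorH2_mk (lam : k) (f : Cobar.Z2 k (RestrictedEnvelopingAlgebra p k h)) :
    ρ.zOperatorH2 z lam (Submodule.Quotient.mk f) =
      Submodule.Quotient.mk (ρ.zOperatorZ2 z lam f) := rfl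

/-- A class in `H²(Ω u(h))` is `z`-characteristic if the `z`-operator kills it. -/
def IsZCharacteristic (lam : k) (ξ : Cobar.H2 k (RestrictedEnvelopingAlgebra p k h)) : Prop :=
  ρ.zOperatorH2 z lam ξ = 0

/-- A class in `H²(Ω u(h))` is admissible if it is `z`-characteristic and has a representing
cocycle `χ` such that `Φ_z(χ) = d¹(a)` and `ρ_z(a) = 0` for some `a` in `u(h)⁺`. -/
def IsAdmissible (lam : k) (ξ : Cobar.H2 k (RestrictedEnvelopingAlgebra p k h)) : Prop :=
  ρ.IsZCharacteristic z lam ξ ∧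
  ∃ χ : Cobar.Z2 k (RestrictedEnvelopingAlgebra p k h), Submodule.Quotient.mk χ = ξ ∧
    ∃ a ∈ Cobar.C1 k (RestrictedEnvelopingAlgebra p k h),
      ρ.zOperator z lam χ = Cobar.d1 k _ a ∧ ρ.act z a = 0

end AlgebraicRep

/-! Write $\Phi_z(\chi)=d^1(a)$ for an arbitrary representative $\chi$ of a $z$-characteristic
class. The cocycle never has to be changed: either $\rho_z(a)=0$ already, or $a$ can be corrected
without changing $d^1(a)$.

If $\mathfrak h$ is a torus, the $p$-th power map on the image of $\mathfrak h$ in $u(\mathfrak h)$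
is injective, because semisimplicity excludes nilpotents. It is Frobenius-semilinear and $k$ is
perfect, so it is also surjective. A derivation kills $p$-th powers in characteristic $p$, hence
$\rho_z=0$ on $u(\mathfrak h)$ (`act_eq_zero_of_isTorus`).

If $\mathfrak g$ is a torus, then $\lambda\neq0$, since otherwise $z$ would be a nonzero nilpotent
of $u(\mathfrak g)$ (`IsTorus.pmap_ne_zero`). The identity $\rho_z^p=-\lambda\rho_z$ extends from
$\mathfrak h$ to $A$ and $A\otimes A$, and gives $\rho_z\Phi_z=0$ (`act2_zOperator`); thus $\rho_z$
kills $d^1(a)$. As $T^p+\lambda T=T(T^{p-1}+\lambda)$ has coprime factors,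
$1+\lambda^{-1}\rho_z^{p-1}$ is the projection onto $\ker\rho_z$. It commutes with $d^1$ and fixes
$d^1(a)$, so it moves $a$ into $\ker\rho_z$ at no cost (`exists_act_eq_zero_of_act2_d1_eq_zero`). -/

/-! ### Nilpotents, semilinear maps and $p$-th powers -/

/-- An algebra generated by one element is commutative, and a commutative semisimple ring is
reduced. -/
theorem eq_zero_of_pow_eq_zero_of_isSemisimpleRing_adjoin {k A : Type*} [Field k] [Ring A]
    [Algebra k A] {x : A} [IsSemisimpleRing (Algebra.adjoin k {x})] {n : ℕ}
    (hx : x ^ n = 0) : x = 0 := by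
  have : IsMulCommutative (Algebra.adjoin k {x}) :=
    Algebra.isMulCommutative_adjoin k (by rintro a rfl b rfl; rfl)
  have h : (⟨x, Algebra.self_mem_adjoin_singleton k x⟩ : Algebra.adjoin k {x}) = 0 :=
    eq_zero_of_pow_eq_zero (n := n) (Subtype.ext hx)
  exact congrArg Subtype.val h

/-- Dimension count: since $\sigma$ is bijective, an injective $\sigma$-semilinear map preserves
dimension, so its range fills $V$. -/
theorem LinearMap.surjective_of_injective_of_bijective {k V : Type*} [Field k] [AddCommGroup V]
    [Module k V] [Module.Finite k V] {σ : k →+* k} (hσ : Function.Bijective σ) (F : V →ₛₗ[σ] V)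
    (hF : Function.Injective F) : Function.Surjective F := by
  have : RingHomSurjective σ := ⟨hσ.2⟩
  rw [← LinearMap.range_eq_top]
  apply Submodule.eq_top_of_finrank_eq
  have hb : Function.Bijective F.rangeRestrict :=
    ⟨fun x y hxy => hF (congrArg Subtype.val hxy), F.surjective_rangeRestrict⟩
  refine (congrArg Cardinal.toNat (rank_eq_of_equiv_equiv σ
    (AddEquiv.ofBijective F.rangeRestrict.toAddMonoidHom hb) hσ fun r m => ?_)).symm
  exact F.rangeRestrict.map_smulₛₗ r m

/-- In a commutative algebra over a perfect field of characteristic `p`, a finite-dimensional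
subspace without nilpotents which is stable under `p`-th powers consists of `p`-th powers. -/
theorem Submodule.exists_mem_pow_eq {p : ℕ} [Fact p.Prime] {k A : Type*} [Field k] [CharP k p]
    [PerfectField k] [CommRing A] [Algebra k A] (V : Submodule k A) [Module.Finite k V]
    (hV : ∀ v ∈ V, v ^ p ∈ V) (h0 : ∀ v ∈ V, v ^ p = 0 → v = 0) {v : A} (hv : v ∈ V) :
    ∃ w ∈ V, w ^ p = v := by
  have : ExpChar k p := ExpChar.prime Fact.out
  let F : V →ₛₗ[frobenius k p] V :=
    { toFun := fun v => ⟨(v : A) ^ p, hV v v.2⟩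
      map_add' := fun v w => Subtype.ext (add_pow_of_algebra k (v : A) w)
      map_smul' := fun c v => Subtype.ext (smul_pow c (v : A) p) }
  have hF : Function.Injective F := by
    rw [injective_iff_map_eq_zero]
    exact fun w hw => Subtype.ext (h0 w w.2 (congrArg Subtype.val hw))
  obtain ⟨w, hw⟩ := LinearMap.surjective_of_injective_of_bijective
    (PerfectRing.bijective_frobenius (R := k) (p := p)) F hF ⟨v, hv⟩
  exact ⟨w, w.2, congrArg Subtype.val hw⟩

/-! ### One-dimensional tori -/

section OneDimensional

variable {p : ℕ} [Fact p.Prime] {k L : Type*} [Field k] [LieRing L] [LieAlgebra k L]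
  [RestrictedLieAlgebra p k L]

namespace RestrictedEnvelopingAlgebra

/-- No Poincaré–Birkhoff–Witt theorem is needed: bracket and $p$-map both vanish on $L$, so
$x\mapsto f(x)\varepsilon$ extends to an algebra map from $u(L)$ to the dual numbers, which detects
$z$ as soon as $f(z)\neq0$. -/
theorem ι_ne_zero_of_finrank_eq_one (hL : Module.finrank k L = 1) {z : L} (hz : z ≠ 0)
    (hpz : pmap p k z = 0) : ι p k z ≠ 0 := by
  have hp : 2 ≤ p := (Fact.out : p.Prime).two_le
  have hspan := (finrank_eq_one_iff_of_nonzero' z hz).mp hL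
  obtain ⟨f, hf⟩ : ∃ f : L →ₗ[k] k, f z ≠ 0 := by
    by_contra! h
    exact hz ((Module.forall_dual_apply_eq_zero_iff k z).mp h)
  have hlie : ∀ x y : L, ⁅x, y⁆ = 0 := by
    intro x y
    obtain ⟨c, rfl⟩ := hspan x
    obtain ⟨d, rfl⟩ := hspan y
    simp
  have hpm : ∀ x : L, pmap p k x = 0 := by
    intro x
    obtain ⟨c, rfl⟩ := hspan x
    rw [RestrictedLieAlgebra.pmap_smul, hpz, smul_zero]
  let φ : RestrictedEnvelopingAlgebra p k L →ₐ[k] DualNumber k :=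
    lift (TrivSqZeroExt.inrHom k k ∘ₗ f)
      (fun x y => by rw [hlie, map_zero, mul_comm, sub_self])
      (fun x => by
        -- Since $p\ge2$, the factor $\varepsilon^2=0$ can be split off from the $p$-th power.
        obtain ⟨m, rfl⟩ := Nat.exists_eq_add_of_le hp
        rw [hpm, map_zero, pow_add, pow_two]
        simp)
  intro h
  have h2 := congrArg φ h
  rw [map_zero, lift_ι] at h2
  exact hf (by simpa using congrArg TrivSqZeroExt.snd h2)

end RestrictedEnvelopingAlgebra

theorem IsTorus.pmap_ne_zero (ht : IsTorus p k L) (hL : Module.finrank k L = 1) {z : L}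
    (hz : z ≠ 0) : pmap p k z ≠ 0 := by
  intro h0
  have := ht.isSemisimple z
  refine RestrictedEnvelopingAlgebra.ι_ne_zero_of_finrank_eq_one (p := p) hL hz h0
    (eq_zero_of_pow_eq_zero_of_isSemisimpleRing_adjoin (k := k) (n := p) ?_)
  rw [RestrictedEnvelopingAlgebra.ι_pow, h0, map_zero]

end OneDimensional

/-! ### Derivations in characteristic $p$ -/

theorem Derivation.map_pow_char {p : ℕ} {k A : Type*} [Field k] [CharP k p]
    [CommRing A] [Algebra k A] (D : Derivation k A A) (a : A) : D (a ^ p) = 0 := by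
  rw [Derivation.leibniz_pow, ← Nat.cast_smul_eq_nsmul k, CharP.cast_eq_zero, zero_smul]

namespace Cobar

variable {p : ℕ} [Fact p.Prime] {k : Type*} [Field k] [CharP k p] {A : Type*} [CommRing A]
  [Bialgebra k A]

/-- The operators $\delta\otimes1$ and $1\otimes\delta$ commute, so the $p$-th power of their sum
has no mixed terms. -/
theorem act2_pow_prime (δ : A →ₗ[k] A) (t : A ⊗[k] A) :
    (act2 δ ^ p) t = act2 (δ ^ p) t := by
  have hc : Commute (δ.rTensor A) (δ.lTensor A) :=
    (LinearMap.rTensor_comp_lTensor A δ δ).trans (LinearMap.lTensor_comp_rTensor A δ δ).symm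
  have h := hc.add_pow_of_algebra (p := p) k
  rw [LinearMap.rTensor_pow, LinearMap.lTensor_pow] at h
  exact LinearMap.congr_fun h t

theorem act2_derivation_pow (D : Derivation k A A) (t : A ⊗[k] A) :
    act2 D.toLinearMap (t ^ p) = 0 := by
  induction t with
  | zero => simp [(Fact.out : p.Prime).ne_zero]
  | add x y hx hy => rw [add_pow_of_algebra k, map_add, hx, hy, add_zero]
  | tmul a b =>
    rw [Algebra.TensorProduct.tmul_pow]
    simp [act2, D.map_pow_char]

theorem mul'_act2_pow (D : Derivation k A A) (n : ℕ) (t : A ⊗[k] A) :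
    LinearMap.mul' k A ((act2 D.toLinearMap ^ n) t) =
      (D.toLinearMap ^ n) (LinearMap.mul' k A t) := by
  have h1 : ∀ t, LinearMap.mul' k A (act2 D.toLinearMap t) =
      D.toLinearMap (LinearMap.mul' k A t) := by
    intro t
    induction t with
    | zero => simp
    | add x y hx hy => simp only [map_add, hx, hy]
    | tmul a b => simp [act2, mul_comm, add_comm]
  induction n with
  | zero => rfl
  | succ n ih => rw [pow_succ', pow_succ', Module.End.mul_apply, Module.End.mul_apply, h1, ih]

/-- The Leibniz rule says that multiplication $A\otimes A\to A$ intertwines $D\otimes1+1\otimes D$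
with $D$. Taking $p$-th powers of both operators shows that $D^p$ is again a derivation. -/
theorem derivation_pow_prime_mul (D : Derivation k A A) (a b : A) :
    (D.toLinearMap ^ p) (a * b) =
      (D.toLinearMap ^ p) a * b + a * (D.toLinearMap ^ p) b := by
  have h := mul'_act2_pow D p (a ⊗ₜ[k] b)
  rw [act2_pow_prime] at h
  simpa [act2] using h.symm

end Cobar

/-! ### The action of $z$ on $u(\mathfrak h)$ and its cobar cochains -/

namespace AlgebraicRep

variable {p : ℕ} [Fact p.Prime] {k g h : Type*} [Field k] [CharP k p] [LieRing g] [LieAlgebra k g]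
  [LieRing h] [LieAlgebra k h] [RestrictedLieAlgebra p k g] [RestrictedLieAlgebra p k h]
  [IsLieAbelian h] (ρ : AlgebraicRep p k g h) (z : g)

open RestrictedEnvelopingAlgebra

theorem act_ι (x : h) : ρ.act z (ι p k x) = ι p k (ρ.toLinearMap z x) :=
  ρ.der_ι z x

theorem act_pow_ι (n : ℕ) (x : h) :
    (ρ.act z ^ n) (ι p k x) = ι p k ((ρ.toLinearMap z ^ n) x) := by
  induction n generalizing x with
  | zero => rfl
  | succ n ih => rw [pow_succ, pow_succ, Module.End.mul_apply, Module.End.mul_apply, act_ι, ih]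

theorem act_algebraMap (c : k) : ρ.act z (algebraMap k _ c) = 0 :=
  (ρ.der z).map_algebraMap c

theorem act_pow_algebraMap {n : ℕ} (hn : n ≠ 0) (c : k) :
    (ρ.act z ^ n) (algebraMap k _ c) = 0 := by
  obtain ⟨m, rfl⟩ := Nat.exists_eq_succ_of_ne_zero hn
  rw [pow_succ, Module.End.mul_apply, act_algebraMap, map_zero]

theorem act_mul (a b : RestrictedEnvelopingAlgebra p k h) :
    ρ.act z (a * b) = ρ.act z a * b + a * ρ.act z b := by
  change ρ.der z (a * b) = ρ.der z a * b + a * ρ.der z b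
  rw [Derivation.leibniz, smul_eq_mul, smul_eq_mul, mul_comm b, add_comm]

variable {z}

/-- Both sides are derivations, and they agree on the generators from $\mathfrak h$ because $\rho$
respects the $p$-map. -/
theorem act_pow_prime {lam : k} (hlam : RestrictedLieAlgebra.pmap p k z + lam • z = 0) :
    ρ.act z ^ p = -lam • ρ.act z := by
  have hρ : ρ.toLinearMap z ^ p = -lam • ρ.toLinearMap z := by
    rw [← ρ.pmap, eq_neg_of_add_eq_zero_left hlam, map_neg, map_smul, neg_smul]
  ext a
  induction a using induction_on with
  | hι x => rw [act_pow_ι, hρ, LinearMap.smul_apply, LinearMap.smul_apply, act_ι, map_smul]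
  | hc c =>
    rw [LinearMap.smul_apply, act_algebraMap, smul_zero]
    exact ρ.act_pow_algebraMap z (Fact.out : p.Prime).ne_zero c
  | hadd a b ha hb => rw [map_add, map_add, ha, hb]
  | hmul a b ha hb =>
    rw [Cobar.derivation_pow_prime_mul, ha, hb]
    simp only [LinearMap.smul_apply]
    rw [act_mul, smul_add, smul_mul_assoc, mul_smul_comm]

/-- The term $f^p$ is killed because $\rho_z$ acts by a derivation; the other two terms give
$\rho_z^p(f)+\lambda\rho_z(f)$, which vanishes by the relation on $z$. -/
theorem act2_zOperator {lam : k} (hlam : RestrictedLieAlgebra.pmap p k z + lam • z = 0)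
    (f : RestrictedEnvelopingAlgebra p k h ⊗[k] RestrictedEnvelopingAlgebra p k h) :
    Cobar.act2 (ρ.act z) (ρ.zOperator z lam f) = 0 := by
  rw [zOperator, Cobar.zOp, map_add, map_add, Cobar.act2_derivation_pow, map_smul,
    ← Module.End.mul_apply, ← pow_succ', Nat.sub_one_add_one (Fact.out : p.Prime).ne_zero,
    Cobar.act2_pow_prime, ρ.act_pow_prime hlam]
  simp only [Cobar.act2, LinearMap.rTensor_smul, LinearMap.lTensor_smul, LinearMap.add_apply,
    LinearMap.smul_apply, neg_smul, smul_add]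
  abel

theorem act_eq_zero_of_isTorus [PerfectField k] (ht : IsTorus p k h) : ρ.act z = 0 := by
  have := ht.finite
  have hι : ∀ x : h, ρ.act z (ι p k x) = 0 := by
    intro x
    -- Working with the image of $\mathfrak h$ in $u(\mathfrak h)$ avoids the injectivity of `ι`;
    -- the image is stable under $p$-th powers since $\iota(y)^p=\iota(y^{[p]})$.
    obtain ⟨w, -, hw⟩ := Submodule.exists_mem_pow_eq (p := p)
      (LinearMap.range (ι p k : h →ₗ[k] RestrictedEnvelopingAlgebra p k h))
      (by rintro _ ⟨y, rfl⟩; exact ⟨_, (ι_pow p k y).symm⟩)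
      (by
        rintro _ ⟨y, rfl⟩ h0
        have := ht.isSemisimple y
        exact eq_zero_of_pow_eq_zero_of_isSemisimpleRing_adjoin (k := k) h0)
      ⟨x, rfl⟩
    rw [← hw]
    exact (ρ.der z).map_pow_char w
  ext a
  induction a using induction_on with
  | hι x => exact hι x
  | hc c => exact ρ.act_algebraMap z c
  | hadd a b ha hb => rw [map_add, ha, hb, map_add]
  | hmul a b ha hb => rw [act_mul, ha, hb]; simp

theorem act_pow_counit (n : ℕ) {a : RestrictedEnvelopingAlgebra p k h}
    (ha : a ∈ Cobar.C1 k (RestrictedEnvelopingAlgebra p k h)) :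
    (ρ.act z ^ n) a ∈ Cobar.C1 k (RestrictedEnvelopingAlgebra p k h) := by
  cases n with
  | zero => exact ha
  | succ n =>
    rw [pow_succ', Module.End.mul_apply]
    exact Cobar.mem_C1.mpr (ρ.counit_act z _)

theorem d1_act_pow (n : ℕ) (a : RestrictedEnvelopingAlgebra p k h) :
    Cobar.d1 k _ ((ρ.act z ^ n) a) = (Cobar.act2 (ρ.act z) ^ n) (Cobar.d1 k _ a) := by
  induction n with
  | zero => rfl
  | succ n ih =>
    rw [pow_succ', pow_succ', Module.End.mul_apply, Module.End.mul_apply,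
      Cobar.d1_act (ρ.der z).map_one_eq_zero (ρ.comul_act z), ih]

theorem exists_act_eq_zero_of_act2_d1_eq_zero {lam : k}
    (hlam : RestrictedLieAlgebra.pmap p k z + lam • z = 0) (hne : lam ≠ 0)
    {a : RestrictedEnvelopingAlgebra p k h}
    (ha : a ∈ Cobar.C1 k (RestrictedEnvelopingAlgebra p k h))
    (hd : Cobar.act2 (ρ.act z) (Cobar.d1 k _ a) = 0) :
    ∃ b ∈ Cobar.C1 k (RestrictedEnvelopingAlgebra p k h),
      Cobar.d1 k _ b = Cobar.d1 k _ a ∧ ρ.act z b = 0 := by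
  have hp : 2 ≤ p := (Fact.out : p.Prime).two_le
  -- The projection of $a$ onto $\ker\rho_z$: the coefficient is forced by
  -- $\rho_z^p=-\lambda\rho_z$.
  refine ⟨a + lam⁻¹ • (ρ.act z ^ (p - 1)) a,
    add_mem ha (Submodule.smul_mem _ _ (ρ.act_pow_counit _ ha)), ?_, ?_⟩
  -- As $p-1\ge1$, at least one factor $\rho_z$ reaches $d^1(a)$, so the correction term is a
  -- cocycle that vanishes under $d^1$.
  · have h1 : p - 1 = p - 2 + 1 := by omega
    rw [map_add, map_smul, d1_act_pow, h1, pow_succ, Module.End.mul_apply, hd, map_zero, smul_zero,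
      add_zero]
  · rw [map_add, map_smul, ← Module.End.mul_apply, ← pow_succ',
      Nat.sub_one_add_one (Fact.out : p.Prime).ne_zero, ρ.act_pow_prime hlam, LinearMap.smul_apply,
      smul_smul, mul_neg, inv_mul_cancel₀ hne, neg_one_smul, add_neg_cancel]

end AlgebraicRep

/-! ### The proposition -/

theorem proposition5p3 {p : ℕ} [Fact p.Prime] {k g h : Type*} [Field k] [CharP k p]
    [PerfectField k] [LieRing g] [LieAlgebra k g] [RestrictedLieAlgebra p k g]
    [LieRing h] [LieAlgebra k h] [RestrictedLieAlgebra p k h]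
    [IsLieAbelian h] [Module.Finite k h] (hg : Module.finrank k g = 1)
    (ρ : AlgebraicRep p k g h) (z : g) (hz : z ≠ 0) (lam : k)
    (hlam : RestrictedLieAlgebra.pmap p k z + lam • z = 0)
    (htorus : IsTorus p k h ∨ IsTorus p k g)
    (ξ : Cobar.H2 k (RestrictedEnvelopingAlgebra p k h)) (hξ : ρ.IsZCharacteristic z lam ξ) :
    ρ.IsAdmissible z lam ξ := by
  refine ⟨hξ, ?_⟩
  obtain ⟨χ, rfl⟩ := Submodule.Quotient.mk_surjective _ ξ
  -- Any representative works; only the cochain that bounds $\Phi_z(\chi)$ may need correcting.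
  refine ⟨χ, rfl, ?_⟩
  obtain ⟨a, ha, had⟩ : ρ.zOperator z lam χ ∈ Cobar.B2 k (RestrictedEnvelopingAlgebra p k h) :=
    (Submodule.Quotient.mk_eq_zero
      ((Cobar.B2 k _).submoduleOf (Cobar.Z2 k (RestrictedEnvelopingAlgebra p k h)))).mp hξ
  rcases htorus with ht | ht
  · exact ⟨a, ha, had.symm, by rw [ρ.act_eq_zero_of_isTorus ht, LinearMap.zero_apply]⟩
  · have hne : lam ≠ 0 := by
      -- For $\lambda=0$ the relation on $z$ reads $z^{[p]}=0$, which a torus excludes.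
      rintro rfl
      exact ht.pmap_ne_zero hg hz (by simpa using hlam)
    obtain ⟨b, hb, hba, hb0⟩ := ρ.exists_act_eq_zero_of_act2_d1_eq_zero hlam hne ha
      (by rw [had]; exact ρ.act2_zOperator hlam _)
    exact ⟨b, hb, by rw [hba, had], hb0⟩
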